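/- Let $1\le n\le d$ be integers. Let $H_0$ be a (random or deterministic) real $d\times n$ matrix that is almost surely nonzero, and let $W_0,W_1,\dots$ be random $d\times d$ matrices whose entries are all i.i.d. $\mathcal N(0,1/d)$ and jointly independent of $H_0$. Define the chain of hidden representations of a batch-normalized linear network by $$H_{\ell+1}=\frac1{\sqrt d}\,BN(W_\ell H_\ell),\qquad BN(M)=\operatorname{diag}(MM^\top)^{-1/2}M\qquad(\ell\ge 0),$$ where $\operatorname{diag}(A)$ is $A$ with its off-diagonal entries set to zero. For a $d\times n$ matrix $H$ let $\sigma_n(H)$ denote its $n$-th largest, i.e. minimum, singular value, and put $\widehat V(H)=\frac1n-\sigma_n(H)^2$. Then for every $\ell\ge 1$, and also for $\ell=0$ if $\|H_0\|_F=1$ almost surely, the random variable $\widehat V(H_{\ell+1})$ is integrable and, almost surely, $$\mathbb E\big[\widehat V(H_{\ell+1})\,\big|\,H_\ell\big]\;\le\;\Big(1-\tfrac23\big(\tfrac1n-\widehat V(H_\ell)\big)\Big)\widehat V(H_\ell)+\frac1{\sqrt d}.$$ No linear-independence assumption on the columns of $H_\ell$ is made. -/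

import Mathlib

open MeasureTheory ProbabilityTheory
open scoped NNReal

namespace BNChain

/-- The entrywise (product, hence Borel) measurable structure on real matrices. -/
instance instMeasurableSpaceMatrix (m n : ℕ) : MeasurableSpace (Matrix (Fin m) (Fin n) ℝ) :=
  inferInstanceAs (MeasurableSpace (Fin m → Fin n → ℝ))

/-- Batch normalization `BN(M) = diag(M Mᵀ)^{-1/2} M`: the `i`-th row of `M` is divided by its
Euclidean norm `√((M Mᵀ) i i)`. -/
noncomputable def batchNorm {d n : ℕ} (M : Matrix (Fin d) (Fin n) ℝ) :
    Matrix (Fin d) (Fin n) ℝ :=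
  Matrix.diagonal (fun i => (√((M * M.transpose) i i))⁻¹) * M

/-- The chain of hidden representations `H_{ℓ+1} = (1/√d) BN(W_ℓ H_ℓ)` started at `H0`. -/
noncomputable def hidden {d n : ℕ} (W : ℕ → Matrix (Fin d) (Fin d) ℝ)
    (H0 : Matrix (Fin d) (Fin n) ℝ) : ℕ → Matrix (Fin d) (Fin n) ℝ
  | 0 => H0
  | ℓ + 1 => (1 / √(d : ℝ)) • batchNorm (W ℓ * hidden W H0 ℓ)

/-- The `n`-th largest (that is, the minimum) singular value `σ_n(H)` of a `d × n` matrix, `n ≥ 1`.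
`LinearMap.singularValues` is the nonincreasing sequence of singular values, indexed from zero. -/
noncomputable def sigmaMin {d n : ℕ} (H : Matrix (Fin d) (Fin n) ℝ) : ℝ :=
  (Matrix.toEuclideanLin H).singularValues (n - 1)

/-- The Lyapunov function `V̂(H) = 1/n - σ_n(H)²`. -/
noncomputable def Vhat {d n : ℕ} (H : Matrix (Fin d) (Fin n) ℝ) : ℝ :=
  1 / (n : ℝ) - sigmaMin H ^ 2

end BNChain

/-! Freeze $H_\ell=H$ and put $s=\sigma_n(H)^2$. The rows of the next representation are $u_i/\sqrt
d$, where the $u_i=w_iH/\|w_iH\|$ are independent with common law, so its Gram matrix is the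
empirical second moment $\frac1d\sum_i u_i^\top u_i$, with mean $M=\mathbb E\,u^\top u$. Two
estimates suffice.

Mean (`le_integral_normalizedRow`): in a basis of right singular vectors $M$ is diagonal with
entries $\mathbb E[\lambda_kz_k^2/\sum_j\lambda_jz_j^2]$, $z$ standard Gaussian and $\lambda_k$ the
squared singular values. The entry of the least $\lambda_k$ is the smallest, and a tangent line for
$1/x$ with the fourth moments of $z/\|z\|$ gives $M\succeq s\,(1+\frac23(\frac1n-s))I$. This needs
only $\|H\|_F\le1$.

Fluctuation (`integral_sqrt_sum_sq_le`): the expected Frobenius distance from the empirical matrix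
to $M$ is at most $1/\sqrt d$, and it bounds the loss in every quadratic form at once.

With $V=\frac1n-s$, the sum is $V-\frac23sV+1/\sqrt d$, as claimed. If $s=0$ the bound is trivial,
so the columns need not be independent. Since $H_\ell$ is independent of $W_\ell$, the fixed-input
bound passes to the conditional expectation. -/

namespace BNChain

/-! ### Moments of the direction of a standard Gaussian vector -/

section Gaussian

variable {ι : Type*} [Fintype ι]

/-- The characteristic function at $t$ depends only on $\|\sum_k t_kf_k\|=\|t\|$. It turns Gaussian
weights into independent coordinates along the left singular vectors. -/
lemma stdGaussian_map_orthonormal {E : Type*} [NormedAddCommGroup E] [InnerProductSpace ℝ E]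
    [FiniteDimensional ℝ E] [MeasurableSpace E] [BorelSpace E] {f : ι → E}
    (hf : Orthonormal ℝ f) :
    (stdGaussian E).map (fun w => WithLp.toLp 2 fun k => inner ℝ (f k) w) =
      stdGaussian (EuclideanSpace ℝ ι) := by
  have hmeas : Measurable (fun w : E => WithLp.toLp 2 fun k => inner ℝ (f k) w) := by
    refine (WithLp.measurable_toLp 2 (ι → ℝ)).comp ?_
    exact measurable_pi_lambda _ fun k => by fun_prop
  have : IsProbabilityMeasure
      ((stdGaussian E).map (fun w => WithLp.toLp 2 fun k => inner ℝ (f k) w)) :=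
    Measure.isProbabilityMeasure_map hmeas.aemeasurable
  apply Measure.ext_of_charFun
  ext t
  have key : ∀ w : E, inner ℝ (WithLp.toLp 2 fun k => inner ℝ (f k) w) t
      = inner ℝ w (∑ k, t k • f k) := by
    intro w
    rw [inner_sum, PiLp.inner_apply]
    refine Finset.sum_congr rfl fun k _ => ?_
    simp [real_inner_smul_right, real_inner_comm]
  have hnorm : ‖∑ k, t k • f k‖ ^ 2 = ‖t‖ ^ 2 := by
    rw [← real_inner_self_eq_norm_sq, hf.inner_sum, EuclideanSpace.real_norm_sq_eq]
    simp [sq]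
  rw [charFun_apply, integral_map hmeas.aemeasurable
    (Measurable.aestronglyMeasurable (by fun_prop))]
  simp_rw [key]
  rw [← charFun_apply, charFun_stdGaussian, charFun_stdGaussian]
  norm_cast
  rw [hnorm]

lemma integral_comp_isometry_stdGaussian {E : Type*} [NormedAddCommGroup E]
    [InnerProductSpace ℝ E] [FiniteDimensional ℝ E] [MeasurableSpace E] [BorelSpace E]
    (L : E ≃ₗᵢ[ℝ] E) (g : E → ℝ) :
    ∫ z, g (L z) ∂stdGaussian E = ∫ z, g z ∂stdGaussian E := by
  conv_rhs => rw [← stdGaussian_map L]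
  exact (L.toHomeomorph.measurableEmbedding.integral_map g).symm

lemma stdGaussian_ae_ne_zero [Nonempty ι] :
    ∀ᵐ z ∂stdGaussian (EuclideanSpace ℝ ι), z ≠ 0 := by
  rw [ae_iff, ← map_pi_eq_stdGaussian, Measure.map_apply (by fun_prop)]
  · have : (WithLp.toLp 2 ⁻¹' {z : EuclideanSpace ℝ ι | ¬ z ≠ 0} : Set (ι → ℝ)) = {0} := by
      ext x; simp
    rw [this]
    have i : ι := Classical.arbitrary ι
    have := nullSingletonClass_gaussianReal (μ := 0) (v := 1) one_ne_zero
    have := Measure.pi_nullSingletonClass (μ := fun _ : ι => gaussianReal 0 1) i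
    exact measure_singleton _
  · simp

lemma integrable_of_measurable_of_abs_le {α : Type*} [MeasurableSpace α] {P : Measure α}
    [IsFiniteMeasure P] {f : α → ℝ} {C : ℝ} (hf : Measurable f) (h : ∀ x, |f x| ≤ C) :
    Integrable f P :=
  Integrable.of_bound hf.aestronglyMeasurable C (Filter.Eventually.of_forall h)

/-- The fourth moment of the normalized linear functional `⟪a, z⟫ / ‖z‖` depends on `‖a‖` only. -/
lemma integral_inner_pow_four_div_eq {E : Type*} [NormedAddCommGroup E]
    [InnerProductSpace ℝ E] [FiniteDimensional ℝ E] [MeasurableSpace E] [BorelSpace E]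
    {a b : E} (hab : ‖a‖ = ‖b‖) :
    ∫ z, inner ℝ a z ^ 4 / ‖z‖ ^ 4 ∂stdGaussian E =
      ∫ z, inner ℝ b z ^ 4 / ‖z‖ ^ 4 ∂stdGaussian E := by
  -- As the norms agree, this reflection carries $a$ to $b$; it preserves both the Gaussian and
  -- $\|z\|$.
  set L := (ℝ ∙ (a - b))ᗮ.reflection with hL
  have hLa : L a = b := Submodule.reflection_sub hab
  rw [← integral_comp_isometry_stdGaussian L (fun z => inner ℝ b z ^ 4 / ‖z‖ ^ 4)]
  refine integral_congr_ae (Filter.Eventually.of_forall fun z => ?_)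
  simp only [L.norm_map]
  rw [← hLa, L.inner_map_map]

lemma integrable_inner_pow_four_div {E : Type*} [NormedAddCommGroup E]
    [InnerProductSpace ℝ E] [FiniteDimensional ℝ E] [MeasurableSpace E] [BorelSpace E] (a : E) :
    Integrable (fun z => inner ℝ a z ^ 4 / ‖z‖ ^ 4) (stdGaussian E) := by
  refine integrable_of_measurable_of_abs_le (C := ‖a‖ ^ 4) (by fun_prop) fun z => ?_
  have h := abs_real_inner_le_norm a z
  rw [abs_div, abs_pow, abs_of_nonneg (by positivity : (0 : ℝ) ≤ ‖z‖ ^ 4)]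
  refine div_le_of_le_mul₀ (by positivity) (by positivity) ?_
  calc _ ≤ (‖a‖ * ‖z‖) ^ 4 := by gcongr
    _ = _ := by ring

lemma sq_apply_le_norm_sq (z : EuclideanSpace ℝ ι) (k : ι) : z k ^ 2 ≤ ‖z‖ ^ 2 := by
  rw [EuclideanSpace.real_norm_sq_eq]
  exact Finset.single_le_sum (f := fun i => z i ^ 2) (fun i _ => sq_nonneg _) (Finset.mem_univ k)

lemma integrable_sq_mul_sq_div (k l : ι) :
    Integrable (fun z : EuclideanSpace ℝ ι => z k ^ 2 * z l ^ 2 / ‖z‖ ^ 4)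
      (stdGaussian (EuclideanSpace ℝ ι)) := by
  refine integrable_of_measurable_of_abs_le (C := 1) (by fun_prop) fun z => ?_
  rw [abs_of_nonneg (by positivity)]
  refine div_le_of_le_mul₀ (by positivity) (by positivity) ?_
  have h1 := sq_apply_le_norm_sq z k
  have h2 := sq_apply_le_norm_sq z l
  calc _ ≤ ‖z‖ ^ 2 * ‖z‖ ^ 2 := by gcongr
    _ = _ := by ring

/-- Polarization: $(z_k+z_l)^4+(z_k-z_l)^4=2z_k^4+2z_l^4+12z_k^2z_l^2$. Since $e_k\pm e_l$ has norm
$\sqrt2$, each term on the left contributes $4c$, with $c$ the pure fourth moment; hence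
$8c=4c+12x$. -/
lemma integral_sq_mul_sq_div_of_ne [DecidableEq ι] (m : ι) {k l : ι} (hkl : k ≠ l) :
    ∫ z, z k ^ 2 * z l ^ 2 / ‖z‖ ^ 4 ∂stdGaussian (EuclideanSpace ℝ ι) =
      (∫ z, z m ^ 4 / ‖z‖ ^ 4 ∂stdGaussian (EuclideanSpace ℝ ι)) / 3 := by
  set P := stdGaussian (EuclideanSpace ℝ ι) with hP
  let e : ι → EuclideanSpace ℝ ι := fun i => EuclideanSpace.single i 1
  have hin : ∀ i z, inner ℝ (e i) z = z i := fun i z => by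
    simp [e, EuclideanSpace.inner_single_left]
  have hq : ∀ i, ∫ z, z i ^ 4 / ‖z‖ ^ 4 ∂P = ∫ z, z m ^ 4 / ‖z‖ ^ 4 ∂P := fun i => by
    have := integral_inner_pow_four_div_eq (a := e i) (b := e m) (by simp [e])
    simpa only [hin] using this
  have hnorm : ∀ s : ℝ, s ^ 2 = 1 → ‖e k + s • e l‖ = ‖√2 • e k‖ := fun s hs => by
    rw [← sq_eq_sq₀ (norm_nonneg _) (norm_nonneg _), norm_add_sq_real, norm_smul, norm_smul,
      real_inner_smul_right, hin, mul_pow, mul_pow, Real.norm_eq_abs, sq_abs, hs]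
    have : e l k = 0 := by simp [e, hkl]
    simp [e, hkl]
    norm_num
  have hsum : ∀ s : ℝ, s ^ 2 = 1 →
      ∫ z, (z k + s * z l) ^ 4 / ‖z‖ ^ 4 ∂P = 4 * ∫ z, z m ^ 4 / ‖z‖ ^ 4 ∂P := fun s hs => by
    have := integral_inner_pow_four_div_eq (hnorm s hs)
    simp only [inner_add_left, real_inner_smul_left, hin] at this
    rw [this, ← hq k, ← integral_const_mul]
    refine integral_congr_ae (Filter.Eventually.of_forall fun z => ?_)
    have h2 : √2 ^ 4 = 4 := by
      rw [show √2 ^ 4 = (√2 ^ 2) ^ 2 by ring, Real.sq_sqrt (by norm_num)]; norm_num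
    simp only [mul_pow, h2]
    ring
  have hint : ∀ s : ℝ, Integrable (fun z => (z k + s * z l) ^ 4 / ‖z‖ ^ 4) P := fun s => by
    have := integrable_inner_pow_four_div (e k + s • e l)
    simpa only [inner_add_left, real_inner_smul_left, hin] using this
  have hint' : ∀ i, Integrable (fun z => z i ^ 4 / ‖z‖ ^ 4) P := fun i => by
    have := integrable_inner_pow_four_div (e i)
    simpa only [hin] using this
  have h1 := hsum 1 (by norm_num)
  have h2 := hsum (-1) (by norm_num)
  have key : ∫ z, ((z k + 1 * z l) ^ 4 / ‖z‖ ^ 4 + (z k + (-1) * z l) ^ 4 / ‖z‖ ^ 4) ∂P =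
      ∫ z, (2 * (z k ^ 4 / ‖z‖ ^ 4) + 2 * (z l ^ 4 / ‖z‖ ^ 4)
        + 12 * (z k ^ 2 * z l ^ 2 / ‖z‖ ^ 4)) ∂P := by
    refine integral_congr_ae (Filter.Eventually.of_forall fun z => ?_)
    simp only
    ring
  have hadd : Integrable (fun z => 2 * (z k ^ 4 / ‖z‖ ^ 4) + 2 * (z l ^ 4 / ‖z‖ ^ 4)) P :=
    ((hint' k).const_mul 2).add ((hint' l).const_mul 2)
  rw [integral_add (hint 1) (hint (-1)), integral_add hadd
    ((integrable_sq_mul_sq_div k l).const_mul 12), integral_add ((hint' k).const_mul 2)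
    ((hint' l).const_mul 2), integral_const_mul, integral_const_mul, integral_const_mul, h1, h2,
    hq k, hq l] at key
  linarith

lemma norm_pow_four_eq_sum (z : EuclideanSpace ℝ ι) :
    ‖z‖ ^ 4 = ∑ k, ∑ l, z k ^ 2 * z l ^ 2 := by
  rw [show ‖z‖ ^ 4 = ‖z‖ ^ 2 * ‖z‖ ^ 2 by ring, EuclideanSpace.real_norm_sq_eq,
    Finset.sum_mul_sum]

/-- Integrating $\sum_{k,l}z_k^2z_l^2/\|z\|^4=1$ gives $Nc+N(N-1)c/3=1$. -/
lemma integral_pow_four_div [DecidableEq ι] (m : ι) :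
    ∫ z, z m ^ 4 / ‖z‖ ^ 4 ∂stdGaussian (EuclideanSpace ℝ ι) =
      3 / (Fintype.card ι * (Fintype.card ι + 2)) := by
  set P := stdGaussian (EuclideanSpace ℝ ι) with hP
  set c := ∫ z, z m ^ 4 / ‖z‖ ^ 4 ∂P with hc
  have : Nonempty ι := ⟨m⟩
  have hn : (0 : ℝ) < Fintype.card ι := by exact_mod_cast Fintype.card_pos
  have hq : ∀ k l : ι, ∫ z, z k ^ 2 * z l ^ 2 / ‖z‖ ^ 4 ∂P = if k = l then c else c / 3 := by
    intro k l
    split_ifs with h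
    · subst h
      have := integral_inner_pow_four_div_eq (a := EuclideanSpace.single k (1 : ℝ))
        (b := EuclideanSpace.single m (1 : ℝ)) (by simp)
      simp only [EuclideanSpace.inner_single_left, map_one, one_mul] at this
      rw [hc, hP, ← this]
      refine integral_congr_ae (Filter.Eventually.of_forall fun z => ?_)
      simp only
      ring
    · exact integral_sq_mul_sq_div_of_ne m h
  have h1 : ∫ z, (∑ k, ∑ l, z k ^ 2 * z l ^ 2 / ‖z‖ ^ 4) ∂P = 1 := by
    have : (fun z : EuclideanSpace ℝ ι => ∑ k, ∑ l, z k ^ 2 * z l ^ 2 / ‖z‖ ^ 4) =ᵐ[P]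
        fun _ => 1 := by
      filter_upwards [stdGaussian_ae_ne_zero] with z hz
      simp_rw [← Finset.sum_div, ← norm_pow_four_eq_sum]
      exact div_self (pow_ne_zero _ (norm_ne_zero_iff.2 hz))
    rw [integral_congr_ae this]; simp
  rw [integral_finsetSum _ fun k _ => integrable_finsetSum _ fun l _ =>
    integrable_sq_mul_sq_div k l] at h1
  simp_rw [integral_finsetSum _ fun l _ => integrable_sq_mul_sq_div _ l] at h1
  have h2 : ∀ k l : ι, (if k = l then c else c / 3) = c / 3 + if k = l then 2 / 3 * c else 0 := by
    intro k l; split_ifs <;> ring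
  simp only [← hP, hq, h2, Finset.sum_add_distrib, Finset.sum_const, Finset.card_univ,
    nsmul_eq_mul, Finset.sum_ite_eq, Finset.mem_univ, if_true] at h1
  field_simp
  linarith

lemma integral_sq_div_norm_sq [DecidableEq ι] (m : ι) :
    ∫ z, z m ^ 2 / ‖z‖ ^ 2 ∂stdGaussian (EuclideanSpace ℝ ι) = 1 / Fintype.card ι := by
  have : Nonempty ι := ⟨m⟩
  have hn : (0 : ℝ) < Fintype.card ι := by exact_mod_cast Fintype.card_pos
  have h : ∀ z : EuclideanSpace ℝ ι,
      z m ^ 2 / ‖z‖ ^ 2 = ∑ l, z m ^ 2 * z l ^ 2 / ‖z‖ ^ 4 := by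
    intro z
    rw [← Finset.sum_div, ← Finset.mul_sum, ← EuclideanSpace.real_norm_sq_eq]
    rcases eq_or_ne z 0 with rfl | hz
    · simp
    · have := norm_ne_zero_iff.2 hz
      field_simp
  simp_rw [h]
  rw [integral_finsetSum _ fun l _ => integrable_sq_mul_sq_div m l,
    ← Finset.add_sum_erase _ _ (Finset.mem_univ m)]
  rw [Finset.sum_congr rfl fun l hl =>
    integral_sq_mul_sq_div_of_ne m (Finset.ne_of_mem_erase hl).symm]
  have : ∫ z, z m ^ 2 * z m ^ 2 / ‖z‖ ^ 4 ∂stdGaussian (EuclideanSpace ℝ ι) =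
      ∫ z, z m ^ 4 / ‖z‖ ^ 4 ∂stdGaussian (EuclideanSpace ℝ ι) := by
    congr 1; ext z; ring
  rw [this, integral_pow_four_div]
  simp only [Finset.sum_const, nsmul_eq_mul, Finset.card_erase_of_mem (Finset.mem_univ m),
    Finset.card_univ]
  rw [Nat.cast_sub (Nat.one_le_iff_ne_zero.2 Fintype.card_ne_zero)]
  push_cast
  field_simp
  ring

end Gaussian

/-! ### Normalized weighted squares of Gaussian coordinates -/

section WeightedRatio

variable {ι : Type*} [Fintype ι]

lemma abs_mul_div_sum_sq_le (g : ι → ℝ) (k l : ι) : |g k * g l / ∑ j, g j ^ 2| ≤ 1 := by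
  have hk := Finset.single_le_sum (f := fun i => g i ^ 2) (fun i _ => sq_nonneg _)
    (Finset.mem_univ k)
  have hl := Finset.single_le_sum (f := fun i => g i ^ 2) (fun i _ => sq_nonneg _)
    (Finset.mem_univ l)
  have h0 : 0 ≤ ∑ j, g j ^ 2 := Finset.sum_nonneg fun i _ => sq_nonneg _
  rw [abs_div, abs_of_nonneg h0]
  refine div_le_of_le_mul₀ h0 zero_le_one ?_
  rw [one_mul, abs_le]
  constructor <;> nlinarith [sq_nonneg (g k + g l), sq_nonneg (g k - g l)]

variable {lam : ι → ℝ}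

lemma sum_sqrt_mul_sq (hlam : ∀ k, 0 < lam k) (z : ι → ℝ) :
    ∑ j, (√(lam j) * z j) ^ 2 = ∑ j, lam j * z j ^ 2 :=
  Finset.sum_congr rfl fun j _ => by rw [mul_pow, Real.sq_sqrt (hlam j).le]

lemma integrable_mul_div_weighted (hlam : ∀ k, 0 < lam k) (k l : ι) :
    Integrable (fun z : EuclideanSpace ℝ ι =>
      (√(lam k) * z k) * (√(lam l) * z l) / ∑ j, lam j * z j ^ 2)
      (stdGaussian (EuclideanSpace ℝ ι)) := by
  refine integrable_of_measurable_of_abs_le (C := 1) (by fun_prop) fun z => ?_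
  rw [← sum_sqrt_mul_sq hlam]
  exact abs_mul_div_sum_sq_le (fun j => √(lam j) * z j) k l

lemma integrable_sq_div_weighted (hlam : ∀ k, 0 < lam k) (k : ι) :
    Integrable (fun z : EuclideanSpace ℝ ι => lam k * z k ^ 2 / ∑ j, lam j * z j ^ 2)
      (stdGaussian (EuclideanSpace ℝ ι)) := by
  refine (integrable_mul_div_weighted hlam k k).congr (Filter.Eventually.of_forall fun z => ?_)
  simp only
  rw [← sq, mul_pow, Real.sq_sqrt (hlam k).le]

lemma weighted_pos (hlam : ∀ k, 0 < lam k) {z : EuclideanSpace ℝ ι} (hz : z ≠ 0) :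
    0 < ∑ j, lam j * z j ^ 2 := by
  obtain ⟨i, hi⟩ : ∃ i, z i ≠ 0 := by
    by_contra! h
    exact hz (by ext i; simpa using h i)
  exact Finset.sum_pos' (fun j _ => mul_nonneg (hlam j).le (sq_nonneg _))
    ⟨i, Finset.mem_univ i, mul_pos (hlam i) (by positivity)⟩

variable [DecidableEq ι]

/-- Lower bound for a normalized weighted square, from the tangent line of `x ↦ 1 / x`. -/
lemma le_integral_sq_div_weighted (hlam : ∀ k, 0 < lam k) (hsum : ∑ k, lam k ≤ 1) {m : ι}
    (hm : lam m ≤ 1 / Fintype.card ι) :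
    lam m * (1 + 2 / 3 * (1 / Fintype.card ι - lam m)) ≤
      ∫ z, lam m * z m ^ 2 / (∑ j, lam j * z j ^ 2) ∂stdGaussian (EuclideanSpace ℝ ι) := by
  set P := stdGaussian (EuclideanSpace ℝ ι) with hP
  have : Nonempty ι := ⟨m⟩
  set N : ℝ := (Fintype.card ι : ℝ) with hN
  have hn : 1 ≤ N := by rw [hN]; exact_mod_cast Fintype.card_pos
  -- The tangent point is $\|z\|^2/N$, the value of the denominator when all weights equal $1/N$.
  -- The defect is a multiple of the square $(\|z\|^2-NX)^2$.
  have hpt : ∀ᵐ z ∂P, lam m * (2 * N * (z m ^ 2 / ‖z‖ ^ 2) -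
      N ^ 2 * ∑ j, lam j * (z m ^ 2 * z j ^ 2 / ‖z‖ ^ 4)) ≤
        lam m * z m ^ 2 / ∑ j, lam j * z j ^ 2 := by
    filter_upwards [stdGaussian_ae_ne_zero] with z hz
    have hX := weighted_pos hlam hz
    have hY : 0 < ‖z‖ := norm_pos_iff.2 hz
    have h1 : ∑ j, lam j * (z m ^ 2 * z j ^ 2 / ‖z‖ ^ 4) =
        z m ^ 2 * (∑ j, lam j * z j ^ 2) / ‖z‖ ^ 4 := by
      rw [Finset.mul_sum, Finset.sum_div]
      exact Finset.sum_congr rfl fun j _ => by ring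
    rw [h1, mul_div_assoc (lam m)]
    refine mul_le_mul_of_nonneg_left ?_ (hlam m).le
    set X := ∑ j, lam j * z j ^ 2
    rw [← sub_nonneg]
    have h2 : z m ^ 2 / X - (2 * N * (z m ^ 2 / ‖z‖ ^ 2) - N ^ 2 * (z m ^ 2 * X / ‖z‖ ^ 4)) =
        z m ^ 2 * (‖z‖ ^ 2 - N * X) ^ 2 / (X * ‖z‖ ^ 4) := by
      field_simp
      ring
    rw [h2]
    positivity
  have hi2 : Integrable (fun z : EuclideanSpace ℝ ι => z m ^ 2 / ‖z‖ ^ 2) P := by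
    refine integrable_of_measurable_of_abs_le (C := 1) (by fun_prop) fun z => ?_
    rw [abs_of_nonneg (by positivity)]
    exact div_le_of_le_mul₀ (by positivity) zero_le_one (by simpa using sq_apply_le_norm_sq z m)
  have hi4 : Integrable (fun z : EuclideanSpace ℝ ι =>
      ∑ j, lam j * (z m ^ 2 * z j ^ 2 / ‖z‖ ^ 4)) P :=
    integrable_finsetSum _ fun j _ => (integrable_sq_mul_sq_div m j).const_mul _
  have hle := integral_mono_ae (((hi2.const_mul (2 * N)).sub (hi4.const_mul (N ^ 2))).const_mul
    (lam m)) (integrable_sq_div_weighted hlam m) hpt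
  refine le_trans ?_ hle
  have hq : ∀ j, ∫ z : EuclideanSpace ℝ ι, z m ^ 2 * z j ^ 2 / ‖z‖ ^ 4 ∂P =
      (1 + if j = m then 2 else 0) / (N * (N + 2)) := by
    intro j
    split_ifs with h
    · subst h
      have := integral_pow_four_div j
      rw [← hP, ← hN] at this
      rw [show (1 + 2 : ℝ) = 3 by norm_num, ← this]
      congr 1; ext z; ring
    · rw [hP, integral_sq_mul_sq_div_of_ne m (Ne.symm h), integral_pow_four_div]
      field_simp
      ring
  simp only [Pi.sub_apply]
  rw [integral_const_mul, integral_sub (hi2.const_mul _) (hi4.const_mul _), integral_const_mul,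
    integral_const_mul, hP, integral_sq_div_norm_sq, ← hP, ← hN,
    integral_finsetSum _ fun j _ => (integrable_sq_mul_sq_div m j).const_mul _]
  rw [Finset.sum_congr rfl fun j _ => (integral_const_mul _ _).trans (congrArg _ (hq j))]
  have hS : ∑ j, lam j * ((1 + if j = m then 2 else 0) / (N * (N + 2))) =
      (∑ j, lam j + lam m * 2) / (N * (N + 2)) := by
    simp_rw [← mul_div_assoc, ← Finset.sum_div, mul_add, mul_one, Finset.sum_add_distrib,
      mul_ite, mul_zero, Finset.sum_ite_eq', Finset.mem_univ, if_true]
  rw [hS]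
  refine mul_le_mul_of_nonneg_left ?_ (hlam m).le
  have h0 : (0 : ℝ) < N := by linarith
  rw [le_div_iff₀ h0] at hm
  have e1 : 2 * N * (1 / N) - N ^ 2 * ((∑ j, lam j + lam m * 2) / (N * (N + 2))) =
      (2 * (N + 2) - N * (∑ j, lam j + lam m * 2)) / (N + 2) := by
    field_simp
  rw [e1, le_div_iff₀ (by linarith)]
  have e2 : (1 + 2 / 3 * (1 / N - lam m)) * (N + 2) =
      (N + 2) + 2 / 3 * (1 - lam m * N) * (N + 2) / N := by
    field_simp
  rw [e2]
  -- The moments yield the coefficient $2N/(N+2)$, which for $N\ge1$ is least at $N=1$: this is the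
  -- $2/3$.
  have e3 : 2 / 3 * (1 - lam m * N) * (N + 2) / N ≤ 2 * (1 - lam m * N) := by
    rw [div_le_iff₀ h0]
    nlinarith
  nlinarith

/-- After exchanging $z_m$ and $z_k$ in the left integral, both numerators contain $z_k^2$ and the
integrands compare pointwise. -/
lemma integral_sq_div_weighted_mono (hlam : ∀ k, 0 < lam k) {m k : ι} (hmk : lam m ≤ lam k) :
    ∫ z, lam m * z m ^ 2 / (∑ j, lam j * z j ^ 2) ∂stdGaussian (EuclideanSpace ℝ ι) ≤
      ∫ z, lam k * z k ^ 2 / (∑ j, lam j * z j ^ 2) ∂stdGaussian (EuclideanSpace ℝ ι) := by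
  rcases eq_or_ne m k with rfl | hne
  · exact le_rfl
  have : Nonempty ι := ⟨m⟩
  set σ := Equiv.swap m k with hσ
  let L := LinearIsometryEquiv.piLpCongrLeft 2 ℝ ℝ σ
  have hL : ∀ (z : EuclideanSpace ℝ ι) j, L z j = z (σ j) := fun z j => by
    simp [L, hσ, LinearIsometryEquiv.piLpCongrLeft_apply, Equiv.piCongrLeft'_apply]
  rw [← integral_comp_isometry_stdGaussian L]
  have hint : Integrable (fun z : EuclideanSpace ℝ ι =>
      lam m * (L z) m ^ 2 / (∑ j, lam j * (L z) j ^ 2)) (stdGaussian (EuclideanSpace ℝ ι)) := by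
    have h := integrable_sq_div_weighted hlam m
    rw [← stdGaussian_map L] at h
    exact (L.toHomeomorph.measurableEmbedding.integrable_map_iff).1 h
  refine integral_mono_ae hint (integrable_sq_div_weighted hlam k) ?_
  filter_upwards [stdGaussian_ae_ne_zero] with z hz
  have hX := weighted_pos hlam hz
  have hX' : 0 < ∑ j, lam j * (L z) j ^ 2 :=
    weighted_pos hlam (z := L z) (by simpa using hz)
  have hdiff : ∑ j, (lam j * (L z) j ^ 2 - lam j * z j ^ 2) =
      (lam m - lam k) * (z k ^ 2 - z m ^ 2) := by
    rw [Fintype.sum_eq_add m k hne]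
    · simp only [hL, hσ, Equiv.swap_apply_left, Equiv.swap_apply_right]; ring
    · rintro j ⟨h1, h2⟩
      simp [hL, hσ, Equiv.swap_apply_of_ne_of_ne h1 h2]
  rw [Finset.sum_sub_distrib] at hdiff
  have hLm : (L z) m = z k := by rw [hL, hσ, Equiv.swap_apply_left]
  have hk : lam k * z k ^ 2 ≤ ∑ j, lam j * z j ^ 2 :=
    Finset.single_le_sum (f := fun i => lam i * z i ^ 2)
      (fun i _ => mul_nonneg (hlam i).le (sq_nonneg _)) (Finset.mem_univ k)
  rw [hLm, div_le_div_iff₀ hX' hX]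
  set X := ∑ j, lam j * z j ^ 2
  have e : ∑ j, lam j * (L z) j ^ 2 = X + (lam m - lam k) * (z k ^ 2 - z m ^ 2) := by linarith
  rw [e]
  have hk0 := hlam k
  have : 0 ≤ z k ^ 2 * ((lam k - lam m) * (X - lam k * z k ^ 2 + lam k * z m ^ 2)) := by
    refine mul_nonneg (sq_nonneg _) (mul_nonneg (by linarith) ?_)
    have := mul_nonneg hk0.le (sq_nonneg (z m))
    linarith
  nlinarith

/-- Flipping the sign of $z_k$ preserves the Gaussian and negates the integrand. -/
lemma integral_mul_div_weighted_of_ne {k l : ι} (hkl : k ≠ l) :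
    ∫ z, (√(lam k) * z k) * (√(lam l) * z l) / (∑ j, lam j * z j ^ 2)
      ∂stdGaussian (EuclideanSpace ℝ ι) = 0 := by
  let L : EuclideanSpace ℝ ι ≃ₗᵢ[ℝ] EuclideanSpace ℝ ι :=
    LinearIsometryEquiv.piLpCongrRight 2 fun i =>
      if i = k then LinearIsometryEquiv.neg ℝ else LinearIsometryEquiv.refl ℝ ℝ
  have hL : ∀ (z : EuclideanSpace ℝ ι) j, L z j = if j = k then - z j else z j := fun z j => by
    simp only [L, LinearIsometryEquiv.piLpCongrRight_apply]
    split_ifs <;> simp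
  have h := integral_comp_isometry_stdGaussian L (fun z =>
    (√(lam k) * z k) * (√(lam l) * z l) / (∑ j, lam j * z j ^ 2))
  have h2 : ∀ (z : EuclideanSpace ℝ ι), (√(lam k) * (L z) k) * (√(lam l) * (L z) l) /
      (∑ j, lam j * (L z) j ^ 2) =
        -((√(lam k) * z k) * (√(lam l) * z l) / (∑ j, lam j * z j ^ 2)) := by
    intro z
    have : ∀ j, (L z) j ^ 2 = z j ^ 2 := fun j => by rw [hL]; split_ifs <;> ring
    simp_rw [this]
    rw [hL, hL, if_pos rfl, if_neg hkl.symm]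
    ring
  simp_rw [h2, integral_neg] at h
  linarith

/-- Cross terms vanish, so the integral is an average, with weights $v_k^2$, of diagonal entries,
the least of which is at $m$. The minimal weight is at most $1/N$ because the weights sum to at most
one. -/
lemma le_integral_inner_sq_div_weighted (hlam : ∀ k, 0 < lam k) (hsum : ∑ k, lam k ≤ 1) {m : ι}
    (hm : ∀ k, lam m ≤ lam k) {v : ι → ℝ} (hv : ∑ k, v k ^ 2 = 1) :
    lam m * (1 + 2 / 3 * (1 / Fintype.card ι - lam m)) ≤
      ∫ z, (∑ k, v k * (√(lam k) * z k)) ^ 2 / (∑ j, lam j * z j ^ 2)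
        ∂stdGaussian (EuclideanSpace ℝ ι) := by
  have : Nonempty ι := ⟨m⟩
  set P := stdGaussian (EuclideanSpace ℝ ι) with hP
  have hcard : lam m ≤ 1 / Fintype.card ι := by
    rw [le_div_iff₀ (by exact_mod_cast Fintype.card_pos)]
    calc lam m * Fintype.card ι = ∑ _k : ι, lam m := by simp [mul_comm]
      _ ≤ ∑ k, lam k := Finset.sum_le_sum fun k _ => hm k
      _ ≤ 1 := hsum
  have hexp : ∀ z : EuclideanSpace ℝ ι,
      (∑ k, v k * (√(lam k) * z k)) ^ 2 / (∑ j, lam j * z j ^ 2) =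
        ∑ k, ∑ l, v k * v l *
          ((√(lam k) * z k) * (√(lam l) * z l) / (∑ j, lam j * z j ^ 2)) := by
    intro z
    rw [sq, Finset.sum_mul_sum, Finset.sum_div]
    refine Finset.sum_congr rfl fun k _ => ?_
    rw [Finset.sum_div]
    exact Finset.sum_congr rfl fun l _ => by ring
  simp_rw [hexp]
  rw [integral_finsetSum _ fun k _ => integrable_finsetSum _ fun l _ =>
    (integrable_mul_div_weighted hlam k l).const_mul _]
  simp_rw [integral_finsetSum _ fun l _ => (integrable_mul_div_weighted hlam _ l).const_mul _,
    integral_const_mul]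
  have hdiag : ∀ k, ∑ l, v k * v l * ∫ z, (√(lam k) * z k) * (√(lam l) * z l) /
      (∑ j, lam j * z j ^ 2) ∂P =
        v k ^ 2 * ∫ z, lam k * z k ^ 2 / (∑ j, lam j * z j ^ 2) ∂P := by
    intro k
    rw [Finset.sum_eq_single k]
    · rw [← sq]
      congr 2
      ext z
      rw [← sq, mul_pow, Real.sq_sqrt (hlam k).le]
    · intro l _ hl
      rw [hP, integral_mul_div_weighted_of_ne hl.symm, mul_zero]
    · simp
  rw [Finset.sum_congr rfl fun k _ => hdiag k]
  calc _ = ∑ k, v k ^ 2 * (lam m * (1 + 2 / 3 * (1 / Fintype.card ι - lam m))) := by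
        rw [← Finset.sum_mul, hv, one_mul]
    _ ≤ _ := Finset.sum_le_sum fun k _ => mul_le_mul_of_nonneg_left
        ((le_integral_sq_div_weighted hlam hsum hcard).trans
          (integral_sq_div_weighted_mono hlam (hm k))) (sq_nonneg _)

end WeightedRatio

/-! ### Smallest singular value: variational form and measurability -/

section SingularValue

variable {d n : ℕ}

/-- An orthonormal basis of right singular vectors, with the squared singular values. -/
lemma exists_singular_basis (hn : 1 ≤ n) (H : Matrix (Fin d) (Fin n) ℝ) :
    ∃ (b : OrthonormalBasis (Fin n) ℝ (EuclideanSpace ℝ (Fin n))) (lam : Fin n → ℝ) (m : Fin n),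
      (∀ k l, inner ℝ (H.toEuclideanLin (b k)) (H.toEuclideanLin (b l)) =
        if k = l then lam k else 0) ∧ (∀ k, lam m ≤ lam k) ∧ lam m = sigmaMin H ^ 2 := by
  set T := H.toEuclideanLin with hT
  have hs := T.isSymmetric_adjoint_comp_self
  have hf : Module.finrank ℝ (EuclideanSpace ℝ (Fin n)) = n := finrank_euclideanSpace_fin
  -- Eigenvalues of the Gram operator are listed in nonincreasing order from index zero, so the last
  -- one is the minimum.
  refine ⟨hs.eigenvectorBasis hf, hs.eigenvalues hf, ⟨n - 1, by omega⟩, ?_, ?_, ?_⟩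
  · intro k l
    rw [← LinearMap.adjoint_inner_right, ← LinearMap.comp_apply, hs.apply_eigenvectorBasis,
      inner_smul_right, OrthonormalBasis.inner_eq_ite]
    split_ifs with h <;> simp [h]
  · intro k
    exact hs.eigenvalues_antitone hf (Fin.le_def.2 (by simp; omega))
  · rw [sigmaMin, T.sq_singularValues_of_lt hf (by omega)]

lemma inner_toEuclideanLin_single (H : Matrix (Fin d) (Fin n) ℝ) (j : Fin n)
    (w : EuclideanSpace ℝ (Fin d)) :
    inner ℝ (H.toEuclideanLin (EuclideanSpace.single j 1)) w = Matrix.vecMul w.ofLp H j := by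
  rw [PiLp.inner_apply]
  simp [Matrix.toLpLin_apply, Matrix.vecMul, dotProduct]

/-- Both sides are $\|H^\top w\|^2$, computed in two orthonormal bases. -/
lemma sum_sq_inner_toEuclideanLin (H : Matrix (Fin d) (Fin n) ℝ)
    (b : OrthonormalBasis (Fin n) ℝ (EuclideanSpace ℝ (Fin n))) (w : EuclideanSpace ℝ (Fin d)) :
    ∑ k, inner ℝ (H.toEuclideanLin (b k)) w ^ 2 = ∑ j, Matrix.vecMul w.ofLp H j ^ 2 := by
  simp_rw [← inner_toEuclideanLin_single, ← LinearMap.adjoint_inner_right]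
  rw [b.sum_sq_inner_right]
  have := (EuclideanSpace.basisFun (Fin n) ℝ).sum_sq_inner_right
    (LinearMap.adjoint H.toEuclideanLin w)
  simpa using this.symm

lemma sum_sq_norm_toEuclideanLin (H : Matrix (Fin d) (Fin n) ℝ)
    (b : OrthonormalBasis (Fin n) ℝ (EuclideanSpace ℝ (Fin n))) :
    ∑ k, ‖H.toEuclideanLin (b k)‖ ^ 2 = ∑ i, ∑ j, H i j ^ 2 := by
  have h : ∀ k, ‖H.toEuclideanLin (b k)‖ ^ 2 =
      ∑ i, inner ℝ (H.toEuclideanLin (b k)) (EuclideanSpace.single i 1) ^ 2 := fun k => by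
    rw [EuclideanSpace.real_norm_sq_eq]
    simp [EuclideanSpace.inner_single_right]
  simp_rw [h]
  rw [Finset.sum_comm]
  refine Finset.sum_congr rfl fun i _ => ?_
  rw [sum_sq_inner_toEuclideanLin]
  simp

lemma inner_toEuclideanLin_eq_sum (H : Matrix (Fin d) (Fin n) ℝ)
    (b : OrthonormalBasis (Fin n) ℝ (EuclideanSpace ℝ (Fin n)))
    (v : EuclideanSpace ℝ (Fin n)) (w : EuclideanSpace ℝ (Fin d)) :
    inner ℝ (H.toEuclideanLin v) w =
      ∑ k, inner ℝ (b k) v * inner ℝ (H.toEuclideanLin (b k)) w := by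
  conv_lhs => rw [← b.sum_repr' v, map_sum, sum_inner]
  simp [real_inner_smul_left]

lemma sigmaMin_sq_le (hn : 1 ≤ n) (H : Matrix (Fin d) (Fin n) ℝ)
    {v : EuclideanSpace ℝ (Fin n)} (hv : ‖v‖ = 1) :
    sigmaMin H ^ 2 ≤ ‖H.toEuclideanLin v‖ ^ 2 := by
  obtain ⟨b, lam, m, hb, hm, hmin⟩ := exists_singular_basis hn H
  rw [← real_inner_self_eq_norm_sq, inner_toEuclideanLin_eq_sum H b]
  have h : ∀ k, inner ℝ (H.toEuclideanLin (b k)) (H.toEuclideanLin v) =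
      inner ℝ (b k) v * lam k := fun k => by
    rw [real_inner_comm, inner_toEuclideanLin_eq_sum H b]
    simp_rw [hb, mul_ite, mul_zero]
    simp
  simp_rw [h]
  calc sigmaMin H ^ 2 = ∑ k, inner ℝ (b k) v ^ 2 * lam m := by
        rw [← Finset.sum_mul, b.sum_sq_inner_right, hv, hmin]; ring
    _ ≤ _ := Finset.sum_le_sum fun k _ => by
        nlinarith [mul_le_mul_of_nonneg_left (hm k) (sq_nonneg (inner ℝ (b k) v))]

lemma exists_norm_sq_eq_sigmaMin_sq (hn : 1 ≤ n) (H : Matrix (Fin d) (Fin n) ℝ) :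
    ∃ v : EuclideanSpace ℝ (Fin n), ‖v‖ = 1 ∧ ‖H.toEuclideanLin v‖ ^ 2 = sigmaMin H ^ 2 := by
  obtain ⟨b, lam, m, hb, -, hmin⟩ := exists_singular_basis hn H
  refine ⟨b m, b.norm_eq_one m, ?_⟩
  rw [← real_inner_self_eq_norm_sq, hb, if_pos rfl, hmin]

/-- As a minimum over unit $v$ of the continuous functions $\|Hv\|^2$, it has open strict sublevel
sets, even though the union over $v$ is uncountable. -/
lemma measurable_sigmaMin_sq (hn : 1 ≤ n) :
    Measurable fun H : Matrix (Fin d) (Fin n) ℝ => sigmaMin H ^ 2 := by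
  have : @Measurable (Fin d → Fin n → ℝ) ℝ _ _ fun H => sigmaMin (Matrix.of H) ^ 2 := by
    refine measurable_of_Iio fun c => IsOpen.measurableSet ?_
    have : (fun H : Fin d → Fin n → ℝ => sigmaMin (Matrix.of H) ^ 2) ⁻¹' Set.Iio c =
        ⋃ v : {v : EuclideanSpace ℝ (Fin n) // ‖v‖ = 1},
          {H : Fin d → Fin n → ℝ | ‖(Matrix.of H).toEuclideanLin v.1‖ ^ 2 < c} := by
      ext H
      simp only [Set.mem_preimage, Set.mem_Iio, Set.mem_iUnion, Set.mem_ofPred_eq]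
      constructor
      · intro h
        obtain ⟨v, hv, hv'⟩ := exists_norm_sq_eq_sigmaMin_sq hn (Matrix.of H)
        exact ⟨⟨v, hv⟩, by rwa [hv']⟩
      · rintro ⟨⟨v, hv⟩, h⟩
        exact (sigmaMin_sq_le hn _ hv).trans_lt h
    rw [this]
    refine isOpen_iUnion fun v => isOpen_lt ?_ continuous_const
    simp_rw [EuclideanSpace.real_norm_sq_eq, Matrix.toLpLin_apply, Matrix.mulVec, dotProduct]
    simp only [Matrix.of_apply]
    fun_prop
  exact this

lemma measurable_Vhat (hn : 1 ≤ n) :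
    Measurable (Vhat : Matrix (Fin d) (Fin n) ℝ → ℝ) :=
  (measurable_sigmaMin_sq hn).const_sub _

end SingularValue

/-! ### One layer: normalized rows and their mean second moment -/

section Step

variable {d n : ℕ}

/-- The normalized row `w H / ‖w H‖`. -/
noncomputable def normalizedRow (H : Matrix (Fin d) (Fin n) ℝ) (w : Fin d → ℝ) (j : Fin n) : ℝ :=
  (√(∑ k, Matrix.vecMul w H k ^ 2))⁻¹ * Matrix.vecMul w H j

/-- One layer of the batch-normalized linear network. -/
noncomputable def layer (W : Matrix (Fin d) (Fin d) ℝ) (H : Matrix (Fin d) (Fin n) ℝ) :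
    Matrix (Fin d) (Fin n) ℝ :=
  (1 / √(d : ℝ)) • batchNorm (W * H)

lemma layer_apply (W : Matrix (Fin d) (Fin d) ℝ) (H : Matrix (Fin d) (Fin n) ℝ) (i : Fin d)
    (j : Fin n) : layer W H i j = 1 / √(d : ℝ) * normalizedRow H (W i) j := by
  have h : ∀ k, (W * H) i k = Matrix.vecMul (W i) H k := fun k => by
    simp [Matrix.mul_apply, Matrix.vecMul, dotProduct]
  simp only [layer, batchNorm, normalizedRow, Matrix.smul_apply, Matrix.diagonal_mul, smul_eq_mul]
  rw [Matrix.mul_apply]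
  simp only [Matrix.transpose_apply, h, sq]

/-- Only an inequality: if $wH=0$, the convention $0^{-1}=0$ makes the normalized row zero. -/
lemma sum_normalizedRow_sq_le (H : Matrix (Fin d) (Fin n) ℝ) (w : Fin d → ℝ) :
    ∑ j, normalizedRow H w j ^ 2 ≤ 1 := by
  have h0 : 0 ≤ ∑ k, Matrix.vecMul w H k ^ 2 := Finset.sum_nonneg fun _ _ => sq_nonneg _
  simp_rw [normalizedRow, mul_pow, inv_pow, Real.sq_sqrt h0, ← Finset.mul_sum]
  exact inv_mul_le_one

/-- Scale invariance makes the variance of the weights irrelevant and allows unit variance. -/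
lemma normalizedRow_smul (H : Matrix (Fin d) (Fin n) ℝ) {c : ℝ} (hc : 0 < c) (w : Fin d → ℝ)
    (j : Fin n) : normalizedRow H (c • w) j = normalizedRow H w j := by
  simp only [normalizedRow, Matrix.smul_vecMul, Pi.smul_apply, smul_eq_mul, mul_pow,
    ← Finset.mul_sum]
  rw [Real.sqrt_mul (sq_nonneg c), Real.sqrt_sq hc.le]
  field_simp

lemma sum_mul_normalizedRow_sq (H : Matrix (Fin d) (Fin n) ℝ) (w : Fin d → ℝ) (v : Fin n → ℝ) :
    (∑ j, v j * normalizedRow H w j) ^ 2 =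
      (∑ j, v j * Matrix.vecMul w H j) ^ 2 / ∑ k, Matrix.vecMul w H k ^ 2 := by
  have h0 : 0 ≤ ∑ k, Matrix.vecMul w H k ^ 2 := Finset.sum_nonneg fun _ _ => sq_nonneg _
  simp_rw [normalizedRow, mul_left_comm (v _), ← Finset.mul_sum, mul_pow, inv_pow,
    Real.sq_sqrt h0]
  rw [div_eq_inv_mul]

lemma measurable_entry (i : Fin d) (k : Fin n) :
    Measurable fun H : Matrix (Fin d) (Fin n) ℝ => H i k := by
  have : Measurable fun H : Fin d → Fin n → ℝ => H i k := by fun_prop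
  exact this

lemma measurable_normalizedRow (j : Fin n) :
    Measurable fun p : Matrix (Fin d) (Fin n) ℝ × (Fin d → ℝ) => normalizedRow p.1 p.2 j := by
  have hent : ∀ i k, Measurable fun p : Matrix (Fin d) (Fin n) ℝ × (Fin d → ℝ) => p.1 i k :=
    fun i k => (measurable_entry i k).comp measurable_fst
  have hvec : ∀ k, Measurable fun p : Matrix (Fin d) (Fin n) ℝ × (Fin d → ℝ) =>
      Matrix.vecMul p.2 p.1 k := fun k => by
    simp only [Matrix.vecMul, dotProduct]
    exact Finset.measurable_sum _ fun i _ =>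
      ((measurable_pi_apply i).comp measurable_snd).mul (hent i k)
  unfold normalizedRow
  exact ((Finset.measurable_sum _ fun k _ => (hvec k).pow_const 2).sqrt.inv).mul (hvec j)

lemma measurable_normalizedRow_right (H : Matrix (Fin d) (Fin n) ℝ) :
    Measurable (normalizedRow H) := by
  refine measurable_pi_iff.2 fun j => ?_
  have h : Measurable fun w : Fin d → ℝ => (H, w) := measurable_const.prodMk measurable_id
  have h' := (measurable_normalizedRow j).comp h
  exact h'

lemma measurable_layer :
    Measurable fun p : Matrix (Fin d) (Fin n) ℝ × Matrix (Fin d) (Fin d) ℝ =>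
      layer p.2 p.1 := by
  refine measurable_pi_iff.2 fun i => measurable_pi_iff.2 fun j => ?_
  have h : (fun p : Matrix (Fin d) (Fin n) ℝ × Matrix (Fin d) (Fin d) ℝ => layer p.2 p.1 i j) =
      fun p => 1 / √(d : ℝ) * normalizedRow p.1 (p.2 i) j := by
    ext p; exact layer_apply _ _ _ _
  exact h ▸ (((measurable_normalizedRow j).comp
    (measurable_fst.prodMk ((measurable_pi_apply i).comp measurable_snd))).const_mul _)

lemma sum_layer_sq_le (W : Matrix (Fin d) (Fin d) ℝ) (H : Matrix (Fin d) (Fin n) ℝ) :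
    ∑ i, ∑ j, layer W H i j ^ 2 ≤ 1 := by
  simp_rw [layer_apply, mul_pow, ← Finset.mul_sum]
  rw [div_pow, one_pow, Real.sq_sqrt (Nat.cast_nonneg d)]
  calc _ ≤ 1 / (d : ℝ) * ∑ _i : Fin d, (1 : ℝ) := by
        gcongr with i
        exact sum_normalizedRow_sq_le H (W i)
    _ ≤ 1 := by
        rw [Finset.sum_const, Finset.card_univ, Fintype.card_fin, nsmul_eq_mul, mul_one, one_div]
        exact inv_mul_le_one

lemma norm_sq_toEuclideanLin_layer (W : Matrix (Fin d) (Fin d) ℝ) (H : Matrix (Fin d) (Fin n) ℝ)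
    (v : EuclideanSpace ℝ (Fin n)) :
    ‖(layer W H).toEuclideanLin v‖ ^ 2 =
      1 / d * ∑ i, (∑ j, v j * normalizedRow H (W i) j) ^ 2 := by
  rw [EuclideanSpace.real_norm_sq_eq, Finset.mul_sum]
  refine Finset.sum_congr rfl fun i _ => ?_
  have : (layer W H).toEuclideanLin v i = 1 / √(d : ℝ) * ∑ j, v j * normalizedRow H (W i) j := by
    rw [Matrix.toLpLin_apply, Finset.mul_sum]
    simp only [Matrix.mulVec, dotProduct]
    exact Finset.sum_congr rfl fun j _ => by rw [layer_apply]; ring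
  rw [this, mul_pow, div_pow, one_pow, Real.sq_sqrt (Nat.cast_nonneg d)]

lemma map_smul_pi_gaussianReal (c : ℝ≥0) :
    (Measure.pi fun _ : Fin d => gaussianReal 0 1).map (fun w => (√c : ℝ) • w) =
      Measure.pi fun _ : Fin d => gaussianReal 0 c := by
  have h := Measure.pi_map_pi (μ := fun _ : Fin d => gaussianReal 0 1)
    (f := fun _ x => (√c : ℝ) * x) fun _ => by fun_prop
  have h2 : (gaussianReal 0 1).map (fun x => (√c : ℝ) * x) = gaussianReal 0 c := by
    rw [gaussianReal_map_const_mul]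
    congr 1
    · simp
    · ext; simp
  simp_rw [h2] at h
  exact h

/-- The expected normalized row covariance dominates a multiple of the identity. -/
lemma le_integral_normalizedRow (hn : 1 ≤ n) {H : Matrix (Fin d) (Fin n) ℝ}
    (hH : ∑ i, ∑ j, H i j ^ 2 ≤ 1) (hpos : sigmaMin H ≠ 0) {c : ℝ≥0} (hc : c ≠ 0)
    {v : EuclideanSpace ℝ (Fin n)} (hv : ‖v‖ = 1) :
    sigmaMin H ^ 2 * (1 + 2 / 3 * (1 / n - sigmaMin H ^ 2)) ≤
      ∫ w, (∑ j, v j * normalizedRow H w j) ^ 2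
        ∂Measure.pi fun _ : Fin d => gaussianReal 0 c := by
  obtain ⟨b, lam, m, hb, hm, hmin⟩ := exists_singular_basis hn H
  have hmpos : 0 < lam m := by rw [hmin]; positivity
  have hlam : ∀ k, 0 < lam k := fun k => hmpos.trans_le (hm k)
  set T := H.toEuclideanLin with hT
  have hsum : ∑ k, lam k ≤ 1 := by
    refine le_trans (le_of_eq ?_) hH
    rw [← sum_sq_norm_toEuclideanLin H b]
    exact Finset.sum_congr rfl fun k _ => by rw [← real_inner_self_eq_norm_sq, hb, if_pos rfl]
  -- These are the left singular vectors; all $\lambda_k>0$ is what makes them orthonormal.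
  let f : Fin n → EuclideanSpace ℝ (Fin d) := fun k => (√(lam k))⁻¹ • T (b k)
  have hf : Orthonormal ℝ f := by
    rw [orthonormal_iff_ite]
    intro k l
    simp only [f, real_inner_smul_left, real_inner_smul_right, hb]
    split_ifs with h
    · subst h
      have h1 := Real.mul_self_sqrt (hlam k).le
      have h2 := (Real.sqrt_pos.2 (hlam k)).ne'
      field_simp
      rw [sq, h1]
    · simp
  have hfT : ∀ k w, inner ℝ (T (b k)) w = √(lam k) * inner ℝ (f k) w := fun k w => by
    have h2 := (Real.sqrt_pos.2 (hlam k)).ne'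
    simp only [f, real_inner_smul_left]
    field_simp
  have hvsum : ∑ k, inner ℝ (b k) v ^ 2 = 1 := by rw [b.sum_sq_inner_right, hv, one_pow]
  have main := le_integral_inner_sq_div_weighted hlam hsum hm hvsum
  rw [Fintype.card_fin, ← stdGaussian_map_orthonormal hf, integral_map ?_ ?_] at main
  rotate_left
  · refine Measurable.aemeasurable ((WithLp.measurable_toLp 2 (Fin n → ℝ)).comp ?_)
    exact measurable_pi_lambda _ fun k => by fun_prop
  · exact Measurable.aestronglyMeasurable (by fun_prop)
  rw [← hmin]
  refine main.trans (le_of_eq ?_)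
  have hG : Measurable fun w : Fin d → ℝ => (∑ j, v j * normalizedRow H w j) ^ 2 :=
    (Finset.measurable_sum _ fun j _ => ((measurable_pi_apply j).comp
      (measurable_normalizedRow_right H)).const_mul _).pow_const 2
  rw [← map_smul_pi_gaussianReal c, integral_map (by fun_prop) hG.aestronglyMeasurable]
  have hcs : 0 < √(c : ℝ) := Real.sqrt_pos.2 (by positivity)
  simp_rw [normalizedRow_smul H hcs]
  rw [← map_pi_eq_stdGaussian, integral_map (by fun_prop)
    (Measurable.aestronglyMeasurable (by fun_prop))]
  refine integral_congr_ae (Filter.Eventually.of_forall fun w => ?_)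
  simp only
  rw [sum_mul_normalizedRow_sq]
  have hden := sum_sq_inner_toEuclideanLin H b (WithLp.toLp 2 w)
  have hnum := inner_toEuclideanLin_eq_sum H b v (WithLp.toLp 2 w)
  rw [inner_toEuclideanLin_eq_sum H (EuclideanSpace.basisFun (Fin n) ℝ)] at hnum
  simp only [EuclideanSpace.basisFun_apply, inner_toEuclideanLin_single,
    EuclideanSpace.inner_single_left, map_one, one_mul] at hnum
  rw [hnum, ← hden]
  simp only [← hT, hfT, mul_pow, Real.sq_sqrt (hlam _).le]

end Step

/-! ### Fluctuation of an empirical second moment matrix -/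

section Concentration

variable {Ω : Type*} [MeasurableSpace Ω] {μ : Measure Ω} [IsProbabilityMeasure μ]
variable {ι κ : Type*} [Fintype ι] [Fintype κ]

/-- Variances add under pairwise independence, and each is at most the second moment. -/
lemma integral_sq_sub_mean_le [Nonempty ι] {X : ι → Ω → ℝ} (hX : ∀ i, MemLp (X i) 2 μ)
    (hindep : Pairwise fun i k => IndepFun (X i) (X k) μ) {c : ℝ}
    (hmean : ∀ i, ∫ ω, X i ω ∂μ = c) :
    ∫ ω, (1 / Fintype.card ι * ∑ i, X i ω - c) ^ 2 ∂μ ≤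
      (1 / Fintype.card ι) ^ 2 * ∑ i, ∫ ω, X i ω ^ 2 ∂μ := by
  have hN : (Fintype.card ι : ℝ) ≠ 0 := by exact_mod_cast Fintype.card_ne_zero
  have hint : ∀ i, Integrable (X i) μ := fun i => (hX i).integrable one_le_two
  have hsum : ∫ ω, (∑ i, X i) ω ∂μ = Fintype.card ι * c := by
    simp only [Finset.sum_apply]
    rw [integral_finsetSum _ fun i _ => hint i]
    simp [hmean]
  have hvar := IndepFun.variance_sum (X := X) (s := Finset.univ) (fun i _ => hX i)
    (fun i _ k _ hik => hindep hik)
  rw [variance_eq_integral (memLp_finsetSum' _ fun i _ => hX i).aestronglyMeasurable.aemeasurable,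
    hsum] at hvar
  have h1 : ∀ ω, (1 / Fintype.card ι * ∑ i, X i ω - c) ^ 2 =
      (1 / (Fintype.card ι : ℝ)) ^ 2 * ((∑ i, X i) ω - Fintype.card ι * c) ^ 2 := fun ω => by
    rw [Finset.sum_apply]
    field_simp
  simp_rw [h1]
  rw [integral_const_mul, hvar]
  refine mul_le_mul_of_nonneg_left (Finset.sum_le_sum fun i _ => ?_) (by positivity)
  exact variance_le_expectation_sq (hX i).aestronglyMeasurable

/-- Concentration of the empirical second moment matrix of independent vectors in the unit ball. -/
lemma integral_sqrt_sum_sq_le [Nonempty ι] {u : ι → Ω → κ → ℝ} (hu : ∀ i, Measurable (u i))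
    (hbound : ∀ i ω, ∑ a, u i ω a ^ 2 ≤ 1)
    (hindep : Pairwise fun i k => IndepFun (u i) (u k) μ) {M : κ → κ → ℝ}
    (hM : ∀ i a b, ∫ ω, u i ω a * u i ω b ∂μ = M a b) :
    Integrable (fun ω => √(∑ a, ∑ b,
      (1 / Fintype.card ι * ∑ i, u i ω a * u i ω b - M a b) ^ 2)) μ ∧
    ∫ ω, √(∑ a, ∑ b, (1 / Fintype.card ι * ∑ i, u i ω a * u i ω b - M a b) ^ 2) ∂μ ≤
      1 / √(Fintype.card ι) := by
  have hN : (0 : ℝ) < Fintype.card ι := by exact_mod_cast Fintype.card_pos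
  have hum : ∀ i a, Measurable fun ω => u i ω a := fun i a => (measurable_pi_apply a).comp (hu i)
  have hu1 : ∀ i ω a, |u i ω a| ≤ 1 := fun i ω a => by
    rw [← sq_le_one_iff_abs_le_one]
    exact (Finset.single_le_sum (f := fun a => u i ω a ^ 2) (fun _ _ => sq_nonneg _)
      (Finset.mem_univ a)).trans (hbound i ω)
  have hprod : ∀ i ω a b, |u i ω a * u i ω b| ≤ 1 := fun i ω a b => by
    rw [abs_mul]
    exact mul_le_one₀ (hu1 i ω a) (abs_nonneg _) (hu1 i ω b)
  have hmem : ∀ a b i, MemLp (fun ω => u i ω a * u i ω b) 2 μ := fun a b i =>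
    MemLp.of_bound ((hum i a).mul (hum i b)).aestronglyMeasurable 1
      (Filter.Eventually.of_forall fun ω => hprod i ω a b)
  set Q : Ω → ℝ := fun ω => ∑ a, ∑ b,
    (1 / Fintype.card ι * ∑ i, u i ω a * u i ω b - M a b) ^ 2 with hQ
  have hterm : ∀ a b, MemLp (fun ω => 1 / Fintype.card ι * ∑ i, u i ω a * u i ω b - M a b) 2 μ :=
    fun a b => ((memLp_finsetSum _ fun i _ => hmem a b i).const_mul _).sub (memLp_const _)
  have hQint : Integrable Q μ :=
    integrable_finsetSum _ fun a _ => integrable_finsetSum _ fun b _ => (hterm a b).integrable_sq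
  have hQ0 : ∀ ω, 0 ≤ Q ω := fun ω =>
    Finset.sum_nonneg fun a _ => Finset.sum_nonneg fun b _ => sq_nonneg _
  have hle : ∫ ω, Q ω ∂μ ≤ 1 / Fintype.card ι := by
    calc ∫ ω, Q ω ∂μ
        = ∑ a, ∑ b, ∫ ω, (1 / Fintype.card ι * ∑ i, u i ω a * u i ω b - M a b) ^ 2 ∂μ := by
          rw [hQ, integral_finsetSum _ fun a _ => integrable_finsetSum _ fun b _ =>
            (hterm a b).integrable_sq]
          exact Finset.sum_congr rfl fun a _ =>
            integral_finsetSum _ fun b _ => (hterm a b).integrable_sq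
      _ ≤ ∑ a, ∑ b, (1 / (Fintype.card ι : ℝ)) ^ 2 * ∑ i, ∫ ω, (u i ω a * u i ω b) ^ 2 ∂μ :=
          Finset.sum_le_sum fun a _ => Finset.sum_le_sum fun b _ =>
            integral_sq_sub_mean_le (hmem a b)
              (fun i k hik => (hindep hik).comp
                (show Measurable fun x : κ → ℝ => x a * x b by fun_prop)
                (show Measurable fun x : κ → ℝ => x a * x b by fun_prop)) fun i => hM i a b
      _ = (1 / (Fintype.card ι : ℝ)) ^ 2 * ∑ i, ∫ ω, ∑ a, ∑ b, (u i ω a * u i ω b) ^ 2 ∂μ := by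
          simp_rw [← Finset.mul_sum]
          congr 1
          simp_rw [fun i => integral_finsetSum (μ := μ) Finset.univ
            (f := fun a ω => ∑ b, (u i ω a * u i ω b) ^ 2) fun a _ =>
              integrable_finsetSum _ fun b _ => (hmem a b i).integrable_sq,
            fun i a => integral_finsetSum (μ := μ) Finset.univ
            (f := fun b ω => (u i ω a * u i ω b) ^ 2) fun b _ => (hmem a b i).integrable_sq]
          exact (Finset.sum_congr rfl fun a _ => Finset.sum_comm).trans Finset.sum_comm
      _ ≤ (1 / (Fintype.card ι : ℝ)) ^ 2 * ∑ _i : ι, 1 := by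
          refine mul_le_mul_of_nonneg_left (Finset.sum_le_sum fun i _ => ?_) (by positivity)
          -- The squared Frobenius norm of $u^\top u$ is $\|u\|^4$, so no dimension factor appears.
          have : ∀ ω, ∑ a, ∑ b, (u i ω a * u i ω b) ^ 2 ≤ 1 := fun ω => by
            simp_rw [mul_pow, ← Finset.sum_mul_sum]
            exact mul_le_one₀ (hbound i ω) (Finset.sum_nonneg fun _ _ => sq_nonneg _) (hbound i ω)
          refine (integral_mono (integrable_finsetSum _ fun a _ => integrable_finsetSum _
            fun b _ => (hmem a b i).integrable_sq) (integrable_const (1 : ℝ)) this).trans ?_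
          simp
      _ = 1 / Fintype.card ι := by
          simp only [Finset.sum_const, Finset.card_univ, nsmul_eq_mul, mul_one]
          field_simp
  have hsq : MemLp (fun ω => √(Q ω)) 2 μ := by
    rw [memLp_two_iff_integrable_sq hQint.aestronglyMeasurable.aemeasurable.sqrt.aestronglyMeasurable]
    simpa only [Real.sq_sqrt (hQ0 _)] using hQint
  refine ⟨hsq.integrable one_le_two, ?_⟩
  -- Jensen's inequality $(\mathbb E\sqrt Q)^2\le\mathbb E\,Q$, read off from a nonnegative
  -- variance.
  have hv := variance_nonneg (fun ω => √(Q ω)) μ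
  rw [variance_eq_sub hsq] at hv
  simp only [Pi.pow_apply, Real.sq_sqrt (hQ0 _)] at hv
  rw [← Real.sqrt_one, ← Real.sqrt_div zero_le_one]
  exact Real.le_sqrt_of_sq_le (by linarith)

end Concentration

/-! ### Contraction for a deterministic input -/

section FixedInput

variable {Ω : Type*} [MeasurableSpace Ω] {μ : Measure Ω} [IsProbabilityMeasure μ] {d n : ℕ}

lemma Vhat_le (H : Matrix (Fin d) (Fin n) ℝ) : Vhat H ≤ 1 / n := by
  have := sq_nonneg (sigmaMin H)
  unfold Vhat; linarith

/-- Cauchy–Schwarz against $v\otimes v$, which has unit Frobenius norm. -/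
lemma sum_mul_mul_ge {κ : Type*} [Fintype κ] {v : κ → ℝ} (hv : ∑ a, v a ^ 2 = 1) (D : κ → κ → ℝ) :
    -√(∑ a, ∑ b, D a b ^ 2) ≤ ∑ a, ∑ b, v a * v b * D a b := by
  refine neg_le_of_abs_le (Real.abs_le_sqrt ?_)
  have h := Finset.sum_mul_sq_le_sq_mul_sq (Finset.univ : Finset (κ × κ))
    (fun p => v p.1 * v p.2) (fun p => D p.1 p.2)
  simp only [Fintype.sum_prod_type] at h
  refine h.trans (le_of_eq ?_)
  simp_rw [mul_pow, ← Finset.sum_mul_sum, hv, one_mul]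

lemma abs_Vhat_le_one (hn : 1 ≤ n) {H : Matrix (Fin d) (Fin n) ℝ}
    (hH : ∑ i, ∑ j, H i j ^ 2 ≤ 1) : |Vhat H| ≤ 1 := by
  obtain ⟨v, hv, hv'⟩ := exists_norm_sq_eq_sigmaMin_sq hn H
  obtain ⟨b, lam, m, hb, hm, hmin⟩ := exists_singular_basis hn H
  have h1 : sigmaMin H ^ 2 ≤ 1 := by
    refine le_trans ?_ hH
    rw [← sum_sq_norm_toEuclideanLin H b, ← hmin]
    calc lam m = ‖H.toEuclideanLin (b m)‖ ^ 2 := by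
          rw [← real_inner_self_eq_norm_sq, hb, if_pos rfl]
      _ ≤ _ := Finset.single_le_sum (f := fun k => ‖H.toEuclideanLin (b k)‖ ^ 2)
          (fun _ _ => sq_nonneg _) (Finset.mem_univ m)
  have h2 : (1 : ℝ) / n ≤ 1 := by
    rw [div_le_one (by positivity)]; exact_mod_cast hn
  have h3 : (0 : ℝ) ≤ 1 / n := by positivity
  have h4 := sq_nonneg (sigmaMin H)
  rw [abs_le]
  unfold Vhat
  constructor <;> linarith

lemma integrable_Vhat_layer (hn : 1 ≤ n) {A : Ω → Matrix (Fin d) (Fin d) ℝ} (hA : Measurable A)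
    {H : Ω → Matrix (Fin d) (Fin n) ℝ} (hH : Measurable H) :
    Integrable (fun ω => Vhat (layer (A ω) (H ω))) μ := by
  have hm : Measurable fun ω => layer (A ω) (H ω) := by
    have := measurable_layer.comp (hH.prodMk hA)
    exact this
  exact integrable_of_measurable_of_abs_le ((measurable_Vhat hn).comp hm)
    fun _ => abs_Vhat_le_one hn (sum_layer_sq_le _ _)

/-- The contraction bound in expectation for a deterministic input of Frobenius norm at most one. -/
lemma integral_Vhat_layer_le (hn : 1 ≤ n) (hd : 1 ≤ d) {A : Ω → Matrix (Fin d) (Fin d) ℝ}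
    (hA : Measurable A) {c : ℝ≥0} (hc : c ≠ 0)
    (hlaw : ∀ i, HasLaw (fun ω => A ω i) (Measure.pi fun _ : Fin d => gaussianReal 0 c) μ)
    (hindep : Pairwise fun i k => IndepFun (fun ω => A ω i) (fun ω => A ω k) μ)
    {H : Matrix (Fin d) (Fin n) ℝ} (hH : ∑ i, ∑ j, H i j ^ 2 ≤ 1) :
    ∫ ω, Vhat (layer (A ω) H) ∂μ ≤
      (1 - 2 / 3 * (1 / n - Vhat H)) * Vhat H + 1 / √(d : ℝ) := by
  have hint : Integrable (fun ω => Vhat (layer (A ω) H)) μ :=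
    integrable_Vhat_layer hn hA measurable_const
  -- In the degenerate case the contraction factor is one and $\widehat V\le 1/n$ always holds.
  by_cases hpos : sigmaMin H = 0
  · have hV : Vhat H = 1 / n := by simp [Vhat, hpos]
    refine (integral_mono hint (integrable_const (1 / (n : ℝ))) fun ω => Vhat_le _).trans ?_
    rw [hV]
    simp
  have : Nonempty (Fin d) := ⟨⟨0, hd⟩⟩
  set P := Measure.pi fun _ : Fin d => gaussianReal 0 c with hP
  have hrow := measurable_normalizedRow_right H
  have hAi : ∀ i, Measurable fun ω => A ω i := fun i => (measurable_pi_apply i).comp hA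
  set M : Fin n → Fin n → ℝ := fun a b => ∫ w, normalizedRow H w a * normalizedRow H w b ∂P
    with hM
  have hentry : ∀ a, Measurable fun w => normalizedRow H w a :=
    fun a => (measurable_pi_apply a).comp hrow
  obtain ⟨hQint, hQle⟩ := integral_sqrt_sum_sq_le (μ := μ) (M := M)
    (u := fun i ω => normalizedRow H (A ω i))
    (fun i => hrow.comp (hAi i)) (fun i ω => sum_normalizedRow_sq_le H (A ω i))
    (fun i k hik => (hindep hik).comp hrow hrow) fun i a b =>
      (hlaw i).integral_comp (f := fun w => normalizedRow H w a * normalizedRow H w b)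
        ((hentry a).mul (hentry b)).aestronglyMeasurable
  rw [Fintype.card_fin] at hQint hQle
  set Q : Ω → ℝ := fun ω => √(∑ a, ∑ b, (1 / d * ∑ i, normalizedRow H (A ω i) a *
    normalizedRow H (A ω i) b - M a b) ^ 2) with hQ
  set s := sigmaMin H ^ 2 with hs
  have hMint : ∀ a b, Integrable (fun w => normalizedRow H w a * normalizedRow H w b) P := by
    intro a b
    refine integrable_of_measurable_of_abs_le (C := 1) ((hentry a).mul (hentry b)) fun w => ?_
    have h := sum_normalizedRow_sq_le H w
    have ha := (Finset.single_le_sum (f := fun k => normalizedRow H w k ^ 2)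
      (fun _ _ => sq_nonneg _) (Finset.mem_univ a)).trans h
    have hb := (Finset.single_le_sum (f := fun k => normalizedRow H w k ^ 2)
      (fun _ _ => sq_nonneg _) (Finset.mem_univ b)).trans h
    rw [abs_mul]
    exact mul_le_one₀ ((sq_le_one_iff_abs_le_one _).1 ha) (abs_nonneg _)
      ((sq_le_one_iff_abs_le_one _).1 hb)
  have hexpand : ∀ (v : EuclideanSpace ℝ (Fin n)) (w : Fin d → ℝ),
      (∑ j, v j * normalizedRow H w j) ^ 2 =
        ∑ a, ∑ b, v a * v b * (normalizedRow H w a * normalizedRow H w b) := fun v w => by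
    rw [sq, Finset.sum_mul_sum]
    exact Finset.sum_congr rfl fun a _ => Finset.sum_congr rfl fun b _ => by ring
  have hpt : ∀ ω, Vhat (layer (A ω) H) ≤ 1 / n - s * (1 + 2 / 3 * (1 / n - s)) + Q ω := by
    intro ω
    -- The minimizing direction depends on $\omega$. This is harmless: the bound on the mean matrix
    -- holds for every unit $v$, and the error $Q$ does not involve $v$.
    obtain ⟨v, hv, hv'⟩ := exists_norm_sq_eq_sigmaMin_sq hn (layer (A ω) H)
    have hv1 : ∑ a, v a ^ 2 = 1 := by rw [← EuclideanSpace.real_norm_sq_eq, hv, one_pow]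
    have h1 := le_integral_normalizedRow hn hH hpos hc hv
    simp_rw [hexpand] at h1
    rw [integral_finsetSum _ fun a _ => integrable_finsetSum _ fun b _ =>
      (hMint a b).const_mul _] at h1
    simp_rw [integral_finsetSum _ fun b _ => (hMint _ b).const_mul _, integral_const_mul] at h1
    have h2 := sum_mul_mul_ge hv1 fun a b => 1 / d * ∑ i, normalizedRow H (A ω i) a *
      normalizedRow H (A ω i) b - M a b
    simp_rw [mul_sub, Finset.sum_sub_distrib] at h2
    have h3 : ∑ a, ∑ b, v a * v b * (1 / d * ∑ i, normalizedRow H (A ω i) a *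
        normalizedRow H (A ω i) b) = sigmaMin (layer (A ω) H) ^ 2 := by
      rw [← hv', norm_sq_toEuclideanLin_layer]
      simp_rw [hexpand]
      rw [← (Finset.sum_congr rfl fun a _ => Finset.sum_comm).trans Finset.sum_comm,
        Finset.mul_sum]
      simp_rw [Finset.mul_sum]
      exact Finset.sum_congr rfl fun a _ => Finset.sum_congr rfl fun b _ =>
        Finset.sum_congr rfl fun i _ => by ring
    rw [h3] at h2
    unfold Vhat
    linarith
  have hfin := integral_mono hint ((integrable_const _).add hQint) hpt
  simp only [Pi.add_apply] at hfin
  rw [integral_add (integrable_const _) hQint] at hfin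
  simp only [integral_const, probReal_univ, one_smul] at hfin
  have hVs : Vhat H = 1 / n - s := rfl
  rw [hVs]
  linarith

end FixedInput

/-! ### Independence of blocks and conditioning on an independent variable -/

section Independence

variable {Ω : Type*} [MeasurableSpace Ω] {μ : Measure Ω}

lemma indepFun_restrict_of_disjoint {ι β : Type*} [MeasurableSpace β] {X : ι → Ω → β}
    (hX : ∀ i, Measurable (X i)) (hindep : iIndepFun X μ) {S T : Set ι} (hST : Disjoint S T) :
    IndepFun (fun ω (s : S) => X s ω) (fun ω (t : T) => X t ω) μ := by
  have h := indep_iSup_of_disjoint (fun i => (hX i).comap_le) hindep.iIndep hST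
  have hcomap : ∀ R : Set ι, MeasurableSpace.comap (fun ω (s : R) => X s ω) MeasurableSpace.pi ≤
      ⨆ i ∈ R, MeasurableSpace.comap (X i) inferInstance := fun R => by
    rw [MeasurableSpace.pi, MeasurableSpace.comap_iSup]
    refine iSup_le fun s => ?_
    rw [MeasurableSpace.comap_comp]
    exact le_iSup₂_of_le s.1 s.2 le_rfl
  rw [IndepFun_iff_Indep]
  exact indep_of_indep_of_le_left (indep_of_indep_of_le_right h (hcomap T)) (hcomap S)

/-- Both hypotheses together factor the joint law as a triple product, and product measures are
associative. -/
lemma IndepFun.prodMk_left_of_prodMk_right [IsProbabilityMeasure μ] {α β γ : Type*}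
    [MeasurableSpace α] [MeasurableSpace β] [MeasurableSpace γ] {X : Ω → α} {Y : Ω → β} {Z : Ω → γ}
    (hX : Measurable X) (hY : Measurable Y) (hZ : Measurable Z)
    (h : IndepFun X (fun ω => (Y ω, Z ω)) μ) (hYZ : IndepFun Y Z μ) :
    IndepFun (fun ω => (X ω, Y ω)) Z μ := by
  have hXY : IndepFun X Y μ := h.comp measurable_id measurable_fst
  have := Measure.isProbabilityMeasure_map (μ := μ) hX.aemeasurable
  have := Measure.isProbabilityMeasure_map (μ := μ) hY.aemeasurable
  have := Measure.isProbabilityMeasure_map (μ := μ) hZ.aemeasurable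
  have e1 := (indepFun_iff_map_prod_eq_prod_map_map hX.aemeasurable
    (hY.prodMk hZ).aemeasurable).1 h
  have e2 := (indepFun_iff_map_prod_eq_prod_map_map hY.aemeasurable hZ.aemeasurable).1 hYZ
  have e3 := (indepFun_iff_map_prod_eq_prod_map_map hX.aemeasurable hY.aemeasurable).1 hXY
  rw [indepFun_iff_map_prod_eq_prod_map_map (hX.prodMk hY).aemeasurable hZ.aemeasurable, e3]
  apply (MeasurableEquiv.prodAssoc (α := α) (β := β) (γ := γ)).map_measurableEquiv_injective
  rw [Measure.prodAssoc_prod, ← e2, ← e1, Measure.map_map (by fun_prop)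
    ((hX.prodMk hY).prodMk hZ)]
  rfl

/-- Conditional expectation of a function of two independent variables: integrate out one of
them. -/
lemma condExp_of_indepFun [IsProbabilityMeasure μ] {α β : Type*} [mα : MeasurableSpace α]
    [MeasurableSpace β] [StandardBorelSpace β] [Nonempty β] {X : Ω → α} {Y : Ω → β}
    (hX : Measurable X) (hY : Measurable Y) (h : IndepFun X Y μ) {f : α × β → ℝ}
    (hf : Measurable f) (hint : Integrable (fun ω => f (X ω, Y ω)) μ) :
    μ[fun ω => f (X ω, Y ω) | mα.comap X] =ᵐ[μ] fun ω => ∫ ω', f (X ω, Y ω') ∂μ := by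
  have := Measure.isProbabilityMeasure_map (μ := μ) hX.aemeasurable
  have := Measure.isProbabilityMeasure_map (μ := μ) hY.aemeasurable
  -- Independence says exactly that the conditional law of $Y$ given $X$ is the constant kernel.
  have hcd : condDistrib Y X μ =ᵐ[μ.map X] Kernel.const α (μ.map Y) := by
    refine condDistrib_ae_eq_of_measure_eq_compProd X hY.aemeasurable ?_
    rw [Measure.compProd_const]
    exact (indepFun_iff_map_prod_eq_prod_map_map hX.aemeasurable hY.aemeasurable).1 h
  refine (condExp_prod_ae_eq_integral_condDistrib hX hY.aemeasurable hf.stronglyMeasurable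
    hint).trans ?_
  filter_upwards [ae_of_ae_map hX.aemeasurable hcd] with ω hω
  rw [hω, Kernel.const_apply, integral_map hY.aemeasurable]
  exact (hf.comp measurable_prodMk_left).aestronglyMeasurable

end Independence

/-! ### The chain: current state against fresh weights -/

section Chain

variable {d n : ℕ}

instance instStandardBorelSpaceMatrix (m n : ℕ) :
    StandardBorelSpace (Matrix (Fin m) (Fin n) ℝ) :=
  inferInstanceAs (StandardBorelSpace (Fin m → Fin n → ℝ))

lemma hidden_succ (W : ℕ → Matrix (Fin d) (Fin d) ℝ) (H0 : Matrix (Fin d) (Fin n) ℝ) (ℓ : ℕ) :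
    hidden W H0 (ℓ + 1) = layer (W ℓ) (hidden W H0 ℓ) := rfl

lemma hidden_congr {W W' : ℕ → Matrix (Fin d) (Fin d) ℝ} (H0 : Matrix (Fin d) (Fin n) ℝ) {ℓ : ℕ}
    (h : ∀ k < ℓ, W k = W' k) : hidden W H0 ℓ = hidden W' H0 ℓ := by
  induction ℓ with
  | zero => rfl
  | succ ℓ ih =>
    rw [hidden_succ, hidden_succ, ih fun k hk => h k (by omega), h ℓ (by omega)]

lemma measurable_hidden (ℓ : ℕ) :
    Measurable fun p : Matrix (Fin d) (Fin n) ℝ × (ℕ → Matrix (Fin d) (Fin d) ℝ) =>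
      hidden p.2 p.1 ℓ := by
  induction ℓ with
  | zero => exact measurable_fst
  | succ ℓ ih =>
    have hW : Measurable fun p : Matrix (Fin d) (Fin n) ℝ × (ℕ → Matrix (Fin d) (Fin d) ℝ) =>
      p.2 ℓ := (measurable_pi_apply ℓ).comp measurable_snd
    have := measurable_layer.comp (ih.prodMk hW)
    exact this

variable {Ω : Type*} [MeasurableSpace Ω] {μ : Measure Ω} {W : ℕ → Ω → Matrix (Fin d) (Fin d) ℝ}

lemma measurable_weight_entry (hW : ∀ ℓ, Measurable (W ℓ)) (t : ℕ × Fin d × Fin d) :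
    Measurable fun ω => W t.1 ω t.2.1 t.2.2 :=
  (measurable_entry t.2.1 t.2.2).comp (hW t.1)

lemma pairwise_indepFun_row (hW : ∀ ℓ, Measurable (W ℓ))
    (hindep : iIndepFun (fun (t : ℕ × Fin d × Fin d) ω => W t.1 ω t.2.1 t.2.2) μ) (ℓ : ℕ) :
    Pairwise fun i k => IndepFun (fun ω => W ℓ ω i) (fun ω => W ℓ ω k) μ := by
  intro i k hik
  have hdisj : Disjoint {t : ℕ × Fin d × Fin d | t.2.1 = i} {t | t.2.1 = k} :=
    Set.disjoint_left.2 fun t h1 h2 => hik (h1.symm.trans h2)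
  have h := indepFun_restrict_of_disjoint (measurable_weight_entry hW) hindep hdisj
  exact h.comp
    (φ := fun x j => x ⟨(ℓ, i, j), rfl⟩) (ψ := fun x j => x ⟨(ℓ, k, j), rfl⟩)
    (measurable_pi_lambda _ fun j => measurable_pi_apply _)
    (measurable_pi_lambda _ fun j => measurable_pi_apply _)

lemma hasLaw_row {c : ℝ≥0}
    (hlaw : ∀ ℓ i j, HasLaw (fun ω => W ℓ ω i j) (gaussianReal 0 c) μ)
    (hindep : iIndepFun (fun (t : ℕ × Fin d × Fin d) ω => W t.1 ω t.2.1 t.2.2) μ)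
    (ℓ : ℕ) (i : Fin d) :
    HasLaw (fun ω => W ℓ ω i) (Measure.pi fun _ : Fin d => gaussianReal 0 c) μ := by
  have hinj : Function.Injective fun j : Fin d => (ℓ, i, j) := fun j j' h => by simpa using h
  exact (hindep.precomp hinj).hasLaw_pi fun j => hlaw ℓ i j

lemma indepFun_hidden_weight [IsProbabilityMeasure μ] (hW : ∀ ℓ, Measurable (W ℓ))
    (hindep : iIndepFun (fun (t : ℕ × Fin d × Fin d) ω => W t.1 ω t.2.1 t.2.2) μ)
    {H0 : Ω → Matrix (Fin d) (Fin n) ℝ} (hH0 : Measurable H0)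
    (hH0W : IndepFun H0 (fun ω ℓ => W ℓ ω) μ) (ℓ : ℕ) :
    IndepFun (fun ω => hidden (fun k => W k ω) (H0 ω) ℓ) (W ℓ) μ := by
  -- Zeroing the weights from layer $\ell$ on leaves $H_\ell$ unchanged and makes it a function of
  -- the input and earlier weights only.
  let past : Ω → ℕ → Matrix (Fin d) (Fin d) ℝ := fun ω k => if k < ℓ then W k ω else 0
  have htrunc : Measurable fun V : ℕ → Matrix (Fin d) (Fin d) ℝ =>
      fun k => if k < ℓ then V k else 0 := by
    refine measurable_pi_lambda _ fun k => ?_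
    split_ifs
    · exact measurable_pi_apply k
    · exact measurable_const
  have hWall : Measurable fun ω k => W k ω := measurable_pi_lambda _ hW
  have hpast : Measurable past := htrunc.comp hWall
  have h1 : IndepFun H0 (fun ω => (past ω, W ℓ ω)) μ :=
    hH0W.comp measurable_id (htrunc.prodMk (measurable_pi_apply ℓ))
  have h2 : IndepFun past (W ℓ) μ := by
    have hdisj : Disjoint {t : ℕ × Fin d × Fin d | t.1 < ℓ} {t | t.1 = ℓ} :=
      Set.disjoint_left.2 fun t h1 h2 => by simp at h1 h2; omega
    have h := indepFun_restrict_of_disjoint (measurable_weight_entry hW) hindep hdisj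
    let φ : ({t : ℕ × Fin d × Fin d | t.1 < ℓ} → ℝ) → ℕ → Matrix (Fin d) (Fin d) ℝ :=
      fun x k i j => if hk : k < ℓ then x ⟨(k, i, j), hk⟩ else 0
    let ψ : ({t : ℕ × Fin d × Fin d | t.1 = ℓ} → ℝ) → Matrix (Fin d) (Fin d) ℝ :=
      fun x i j => x ⟨(ℓ, i, j), rfl⟩
    have hφ : Measurable φ := by
      refine measurable_pi_lambda _ fun k => measurable_pi_iff.2 fun i => measurable_pi_iff.2
        fun j => ?_
      by_cases hk : k < ℓ
      · simp only [φ, hk, dif_pos]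
        exact measurable_pi_apply _
      · simp only [φ, hk, dif_neg, not_false_iff]
        exact measurable_const
    have hψ : Measurable ψ :=
      measurable_pi_iff.2 fun i => measurable_pi_iff.2 fun j => measurable_pi_apply _
    have hcomp := h.comp hφ hψ
    have e1 : past = φ ∘ fun ω (s : {t : ℕ × Fin d × Fin d | t.1 < ℓ}) =>
        W s.1.1 ω s.1.2.1 s.1.2.2 := by
      ext ω k i j
      change (if k < ℓ then W k ω else 0) i j = if k < ℓ then W k ω i j else 0
      split_ifs <;> rfl
    rw [e1]
    exact hcomp
  have h3 := IndepFun.prodMk_left_of_prodMk_right hH0 hpast (hW ℓ) h1 h2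
  have h4 := h3.comp (measurable_hidden ℓ) measurable_id
  have e : (fun ω => hidden (fun k => W k ω) (H0 ω) ℓ) =
      (fun p : Matrix (Fin d) (Fin n) ℝ × (ℕ → Matrix (Fin d) (Fin d) ℝ) => hidden p.2 p.1 ℓ) ∘
        fun ω => (H0 ω, past ω) := by
    ext1 ω
    exact hidden_congr (H0 ω) fun k hk => by simp [past, hk]
  rw [e]
  exact h4

end Chain

end BNChain

theorem theorem2 {Ω : Type*} [MeasurableSpace Ω] (μ : Measure Ω) [IsProbabilityMeasure μ]
    (n d : ℕ) (hn : 1 ≤ n) (hnd : n ≤ d)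
    -- the input batch: random or deterministic, almost surely nonzero
    (H0 : Ω → Matrix (Fin d) (Fin n) ℝ) (hH0 : Measurable H0) (hH0_ne : ∀ᵐ ω ∂μ, H0 ω ≠ 0)
    -- the weights: i.i.d. Gaussian entries of mean `0` and variance `1/d`, independent of the input
    (W : ℕ → Ω → Matrix (Fin d) (Fin d) ℝ) (hW : ∀ ℓ, Measurable (W ℓ))
    (hW_law : ∀ ℓ i j, HasLaw (fun ω => W ℓ ω i j) (gaussianReal 0 (1 / (d : ℝ≥0))) μ)
    (hW_indep : iIndepFun (fun (t : ℕ × Fin d × Fin d) ω => W t.1 ω t.2.1 t.2.2) μ)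
    (hH0_W : IndepFun H0 (fun ω ℓ => W ℓ ω) μ)
    -- the chain
    (H : ℕ → Ω → Matrix (Fin d) (Fin n) ℝ)
    (hH : ∀ ℓ ω, H ℓ ω = BNChain.hidden (fun k => W k ω) (H0 ω) ℓ)
    -- the layer; for the input layer, the input has unit Frobenius norm
    (ℓ : ℕ) (hℓ : ℓ = 0 → ∀ᵐ ω ∂μ, ∑ i, ∑ j, H0 ω i j ^ 2 = 1) :
    Integrable (fun ω => BNChain.Vhat (H (ℓ + 1) ω)) μ ∧
      μ[fun ω => BNChain.Vhat (H (ℓ + 1) ω) |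
          MeasurableSpace.comap (H ℓ) (BNChain.instMeasurableSpaceMatrix d n)]
        ≤ᵐ[μ] fun ω =>
          (1 - 2 / 3 * (1 / (n : ℝ) - BNChain.Vhat (H ℓ ω))) * BNChain.Vhat (H ℓ ω)
            + 1 / √(d : ℝ) := by
  obtain rfl : H = fun ℓ ω => BNChain.hidden (fun k => W k ω) (H0 ω) ℓ := by
    ext1 ℓ; ext1 ω; exact hH ℓ ω
  have hHm : Measurable fun ω => BNChain.hidden (fun k => W k ω) (H0 ω) ℓ := by
    have := (BNChain.measurable_hidden ℓ).comp (hH0.prodMk (measurable_pi_lambda _ hW))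
    exact this
  have hd : 1 ≤ d := hn.trans hnd
  have hc : (1 / (d : ℝ≥0)) ≠ 0 := by
    have : (d : ℝ≥0) ≠ 0 := by exact_mod_cast (by omega : d ≠ 0)
    positivity
  have hint := BNChain.integrable_Vhat_layer (μ := μ) hn (hW ℓ) hHm
  refine ⟨hint, ?_⟩
  have hf : Measurable fun p : Matrix (Fin d) (Fin n) ℝ × Matrix (Fin d) (Fin d) ℝ =>
      BNChain.Vhat (BNChain.layer p.2 p.1) := by
    have := (BNChain.measurable_Vhat hn).comp (BNChain.measurable_layer (d := d) (n := n))
    exact this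
  have hcond := BNChain.condExp_of_indepFun hHm (hW ℓ)
    (BNChain.indepFun_hidden_weight hW hW_indep hH0 hH0_W ℓ) hf hint
  -- Past the input, normalization itself bounds the Frobenius norm; only $\ell=0$ needs the
  -- assumption on $H_0$.
  have hfrob : ∀ᵐ ω ∂μ, ∑ i, ∑ j, BNChain.hidden (fun k => W k ω) (H0 ω) ℓ i j ^ 2 ≤ 1 := by
    cases ℓ with
    | zero => filter_upwards [hℓ rfl] with ω hω using hω.le
    | succ ℓ => exact Filter.Eventually.of_forall fun ω => BNChain.sum_layer_sq_le _ _
  filter_upwards [hcond, hfrob] with ω h1 h2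
  exact h1.le.trans (BNChain.integral_Vhat_layer_le hn hd (hW ℓ) hc
    (BNChain.hasLaw_row hW_law hW_indep ℓ) (BNChain.pairwise_indepFun_row hW hW_indep ℓ) h2)
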